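/- An interior $r\ell uz$-groupoid (interior residuated lattice-ordered unital groupoid with zero) is an algebra $\mathbf A=(A,\wedge,\vee,\cdot,\backslash,/,!,1,0)$ such that $(A,\wedge,\vee)$ is a lattice, $\cdot$ is a binary operation (not necessarily associative or commutative) with two-sided unit $1$, for all $x,y,z\in A$ $$x\cdot y\le z\iff y\le x\backslash z\iff x\le z/y,$$ $0$ is an arbitrary element of $A$, and $!$ is a conucleus, i.e. for all $x,y\in A$: $1\le\, !1$, $\;!x\cdot !y\le\, !(x\cdot y)$, $\;!x\le x$, $\;!x\le\, !!x$, and $x\le y$ implies $!x\le\, !y$. It is called integral if it satisfies $(\mathsf i)$. Consider the equations $$(\mathsf e)\ x\cdot y\le y\cdot x,\qquad (\mathsf c)\ x\le x\cdot x,\qquad (\mathsf i)\ x\le 1,\qquad (\mathsf o)\ 0\le x,$$ $$(!\mathsf e)\ !x\cdot y=y\cdot !x,\qquad (!\mathsf c)\ !x\le\, !x\cdot !x,\qquad (!\mathsf i)\ !x\le 1,$$ $$(!\mathsf{a1})\ !x\cdot(y\cdot z)=(!x\cdot y)\cdot z,\qquad (!\mathsf{a2})\ x\cdot(y\cdot !z)=(x\cdot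 y)\cdot !z.$$ Given an algebra $\mathbf A$, the partial subalgebra of $\mathbf A$ with underlying set $B\subseteq A$ is the partial algebra on $B$ in which an operation is defined at a tuple of elements of $B$ exactly when its value in $\mathbf A$ lies in $B$, and then takes that value. An embedding of a partial algebra $\mathbf B$ into an algebra $\mathbf C$ of the same signature is an injective map $h\colon B\to C$ such that $h(f^{\mathbf B}(x_1,\dots,x_n))=f^{\mathbf C}(h(x_1),\dots,h(x_n))$ whenever $f^{\mathbf B}(x_1,\dots,x_n)$ is defined. A class $\mathcal K$ of algebras has the finite embeddability property (FEP) if every finite partial subalgebra of a member of $\mathcal K$ embeds into a finite member of $\mathcal K$. **Corollary.** Let $E\subseteq\{(\mathsf e),(\mathsf c),(\mathsf o),(!\mathsf e),(!\mathsf c),(!\mathsf{a1}),(!\mathsf{a2})\}$ be any set of equations, and let $\mathcal V$ be the variety of all integral interior $r\ell uz$-groupoids satisfying every equation in $E$. Then $\mathcal V$ has the FEP. In particular, for $\mathsf R\subseteq\{\mathsf e,\mathsf c,\mathsf i,\mathsf o\}$ let $\mathsf{NACILL}^0_{\mathsf R}$ be the variety of interior $r\ell uz$-groupoids satisfying $(!\mathsf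 i)$, $(!\mathsf c)$, $(!\mathsf e)$, $(!\mathsf{a1})$, $(!\mathsf{a2})$ and the equations in $\mathsf R$. Then $\mathsf{NACILL}^0_{\mathsf i}$, $\mathsf{NACILL}^0_{\mathsf{ei}}$, $\mathsf{NACILL}^0_{\mathsf{ci}}$, $\mathsf{NACILL}^0_{\mathsf{io}}$, $\mathsf{NACILL}^0_{\mathsf{eio}}$ and $\mathsf{NACILL}^0_{\mathsf{cio}}$ have the FEP. -/

import Mathlib

universe u

/-! ## Partial algebras and the finite embeddability property

A language without relation symbols is an algebraic signature, and its structures are the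
algebras of that signature. -/

/-- A partial `L`-algebra on the set `A`: every `n`-ary operation symbol of `L` is interpreted
by an `n`-ary partial operation on `A`. -/
structure PartialAlgebra (L : FirstOrder.Language.{0, 0}) (A : Type u) where
  /-- the fundamental partial operations -/
  op : ∀ {n : ℕ}, L.Functions n → (Fin n → A) →. A

/-- The partial subalgebra of the `L`-algebra `(A, S)` with underlying set `B`: an operation is
defined at a tuple of `B` if and only if its value in `A` lies in `B`, and then it has that value. -/
def partialSubalgebra (L : FirstOrder.Language.{0, 0}) {A : Type u} (S : L.Structure A)
    (B : Set A) : PartialAlgebra L B where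
  op f xs := ⟨S.funMap f (fun i => (xs i : A)) ∈ B,
    fun h => ⟨S.funMap f (fun i => (xs i : A)), h⟩⟩

/-- `h` is an embedding of the partial `L`-algebra `P` into the (total) `L`-algebra `(C, T)`:
an injective map that preserves the operations wherever they are defined in `P`. -/
structure PartialAlgebra.IsEmbedding {L : FirstOrder.Language.{0, 0}} {B C : Type u}
    (P : PartialAlgebra L B) (T : L.Structure C) (h : B → C) : Prop where
  injective : Function.Injective h
  map_op : ∀ {n : ℕ} (f : L.Functions n) (xs : Fin n → B) (y : B),
    y ∈ P.op f xs → h y = T.funMap f (fun i => h (xs i))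

/-- A class `K` of `L`-algebras has the finite embeddability property: every finite partial
subalgebra of a member of `K` embeds into a finite member of `K`. -/
def HasFEP (L : FirstOrder.Language.{0, 0}) (K : ∀ A : Type u, L.Structure A → Prop) : Prop :=
  ∀ (A : Type u) (S : L.Structure A), K A S → ∀ B : Set A, B.Finite →
    ∃ (C : Type u) (T : L.Structure C), K C T ∧ Finite C ∧
      ∃ h : B → C, (partialSubalgebra L S B).IsEmbedding T h

/-! ## Interior residuated lattice-ordered unital groupoids with zero -/

/-- The operation symbols of the language, indexed by arity. -/
inductive RluzOp : ℕ → Type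
  | meet : RluzOp 2
  | join : RluzOp 2
  | mul : RluzOp 2
  | ldiv : RluzOp 2
  | rdiv : RluzOp 2
  | bang : RluzOp 1
  | one : RluzOp 0
  | zero : RluzOp 0

/-- The algebraic language `{∧, ∨, ·, \, /, !, 1, 0}`. -/
def rluzLanguage : FirstOrder.Language.{0, 0} where
  Functions := RluzOp
  Relations := fun _ => Empty

/-- An interior residuated lattice-ordered unital groupoid with zero. The multiplication need be
neither associative nor commutative, and `0` is an arbitrary element. Here `ldiv x z` is `x \ z`,
`rdiv z y` is `z / y`, and `bang` is the modality `!`, a conucleus. -/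
class InteriorRluzGroupoid (A : Type u) extends Lattice A, MulOneClass A, Zero A where
  ldiv : A → A → A
  rdiv : A → A → A
  bang : A → A
  mul_le_iff_le_ldiv : ∀ x y z : A, x * y ≤ z ↔ y ≤ ldiv x z
  mul_le_iff_le_rdiv : ∀ x y z : A, x * y ≤ z ↔ x ≤ rdiv z y
  one_le_bang_one : 1 ≤ bang 1
  bang_mul_bang_le : ∀ x y : A, bang x * bang y ≤ bang (x * y)
  bang_le : ∀ x : A, bang x ≤ x
  bang_le_bang_bang : ∀ x : A, bang x ≤ bang (bang x)
  bang_mono : ∀ x y : A, x ≤ y → bang x ≤ bang y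

namespace InteriorRluzGroupoid

/-- The algebra `(A, ∧, ∨, ·, \, /, !, 1, 0)` of an interior `rℓuz`-groupoid. -/
@[reducible]
def algebra {A : Type u} (I : InteriorRluzGroupoid A) : rluzLanguage.Structure A where
  funMap := fun {_} f =>
    match f with
    | RluzOp.meet => fun xs => xs 0 ⊓ xs 1
    | RluzOp.join => fun xs => xs 0 ⊔ xs 1
    | RluzOp.mul => fun xs => xs 0 * xs 1
    | RluzOp.ldiv => fun xs => ldiv (xs 0) (xs 1)
    | RluzOp.rdiv => fun xs => rdiv (xs 0) (xs 1)
    | RluzOp.bang => fun xs => bang (xs 0)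
    | RluzOp.one => fun _ => 1
    | RluzOp.zero => fun _ => 0
  RelMap := fun r => nomatch r

end InteriorRluzGroupoid

/-- Names of the equations. -/
inductive RluzEquation : Type
  | e
  | c
  | i
  | o
  | bangE
  | bangC
  | bangI
  | bangA1
  | bangA2

open InteriorRluzGroupoid in
/-- The equation named by the first argument holds in the interior `rℓuz`-groupoid `A`. -/
def RluzEquation.HoldsIn (q : RluzEquation) (A : Type u) [InteriorRluzGroupoid A] : Prop :=
  match q with
  | .e => ∀ x y : A, x * y ≤ y * x
  | .c => ∀ x : A, x ≤ x * x
  | .i => ∀ x : A, x ≤ 1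
  | .o => ∀ x : A, 0 ≤ x
  | .bangE => ∀ x y : A, bang x * y = y * bang x
  | .bangC => ∀ x : A, bang x ≤ bang x * bang x
  | .bangI => ∀ x : A, bang x ≤ 1
  | .bangA1 => ∀ x y z : A, bang x * (y * z) = (bang x * y) * z
  | .bangA2 => ∀ x y z : A, x * (y * bang z) = (x * y) * bang z

/-- The variety of interior `rℓuz`-groupoids axiomatized by the set `E` of equations, as a class
of algebras. -/
def rluzVariety (E : Set RluzEquation) (A : Type u) (S : rluzLanguage.Structure A) : Prop :=
  ∃ I : InteriorRluzGroupoid A, I.algebra = S ∧ ∀ q ∈ E, q.HoldsIn A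

/-- The variety of `NACILL⁰`-algebras that satisfy the equations in `R`. -/
def nacillZero (R : Set RluzEquation) (A : Type u) (S : rluzLanguage.Structure A) : Prop :=
  rluzVariety ({.bangI, .bangC, .bangE, .bangA1, .bangA2} ∪ R) A S

/-! Put `F = B ∪ {0}` and let `M` be the unital submagma of `A` generated by `F`. Closed subsets of
`M` are the intersections of basic sets `{m | u m ≤ d}`, where `d ∈ F` and `u` is a join-preserving
polynomial with coefficients in `M`. They form an interior `rℓuz`-groupoid (`galoisAlgebra`), whose
conucleus closes the set of `!`-fixed members of a closed set; `b ↦ {m | m ≤ b}` embeds `B` into it,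
and the equations transfer from `A`. Finiteness rests on integrality: products lie below their
factors, so a Kruskal argument shows that `M`, and likewise the polynomials under the pointwise
order, have no infinite bad sequence for `≥`. For fixed `d` the basic sets are then down-sets of
`M`, well-quasi-ordered by inclusion, and such a family is finite. Finitely many basic sets have
finitely many intersections. -/

open scoped Pointwise

/-! ### Well-quasi-orders and finiteness -/

/-- In a free magma mapped homomorphically to a preordered magma whose products are below both
factors, evaluation makes the reverse order a well-quasi-order when there are finitely many
generators (a semantic form of Kruskal's theorem for binary trees). -/
theorem FreeMagma.wellQuasiOrdered_eval {ι N : Type*} [Finite ι] [Mul N] [Preorder N]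
    (mul_mono : ∀ a b c d : N, a ≤ b → c ≤ d → a * c ≤ b * d)
    (mul_le_left : ∀ a b : N, a * b ≤ a) (mul_le_right : ∀ a b : N, a * b ≤ b)
    (φ : FreeMagma ι →ₙ* N) :
    WellQuasiOrdered (fun s t : FreeMagma ι => φ t ≤ φ s) := by
  set r : FreeMagma ι → FreeMagma ι → Prop := fun s t => φ t ≤ φ s with hr
  have : IsPreorder (FreeMagma ι) r :=
    { refl := fun _ => le_rfl
      trans := fun _ _ _ h h' => le_trans h' h }
  rw [← Set.partiallyWellOrderedOn_univ_iff,
    Set.PartiallyWellOrderedOn.iff_not_exists_isMinBadSeq FreeMagma.length]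
  rintro ⟨f, hf, hmin⟩
  -- Nash-Williams: `D` contains both factors of every product term of the minimal bad sequence `f`.
  -- Only length and value matter, not the subterm relation.
  let D : Set (FreeMagma ι) := {t | ∃ n, t.length < (f n).length ∧ r t (f n)}
  have hD : D.PartiallyWellOrderedOn r := by
    rw [Set.partiallyWellOrderedOn_iff_exists_lt]
    intro g hg
    choose n hlen hle using hg
    obtain ⟨k₀, hk₀⟩ : ∃ k₀, ∀ k, n k₀ ≤ n k := by
      obtain ⟨k₀, -, h⟩ := WellFounded.has_min (measure n).wf Set.univ ⟨0, trivial⟩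
      exact ⟨k₀, fun k => not_lt.1 (h k trivial)⟩
    -- Follow `f` up to index `n k₀`, then `g` from `k₀` on. This is shorter at `n k₀`, so by
    -- minimality it is not bad.
    have hbad := hmin (n k₀) (fun m => if m < n k₀ then f m else g (k₀ + (m - n k₀)))
      (fun m hm => (if_pos hm).symm) (by simpa using hlen k₀)
    simp only [Set.PartiallyWellOrderedOn.IsBadSeq, Set.mem_univ, implies_true, true_and] at hbad
    push Not at hbad
    obtain ⟨i, j, hij, h⟩ := hbad
    by_cases hj : j < n k₀
    · rw [if_pos hj, if_pos (hij.trans hj)] at h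
      exact absurd h (hf.2 i j hij)
    · rw [if_neg hj] at h
      by_cases hi : i < n k₀
      · rw [if_pos hi] at h
        exact absurd (_root_.trans h (hle _)) (hf.2 _ _ (hi.trans_le (hk₀ _)))
      · rw [if_neg hi] at h
        exact ⟨_, _, by omega, h⟩
  have hprod : ((fun p : FreeMagma ι × FreeMagma ι => p.1 * p.2) ''
      (D ×ˢ D)).PartiallyWellOrderedOn r := by
    refine (hD.prod hD).image_of_monotone_on ?_
    rintro ⟨a, b⟩ - ⟨c, d⟩ - ⟨hac, hbd⟩
    simp only [hr, map_mul]
    exact mul_mono _ _ _ _ hac hbd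
  have hleaf : (Set.range (FreeMagma.of : ι → FreeMagma ι)).PartiallyWellOrderedOn r :=
    (Set.finite_range _).partiallyWellOrderedOn
  obtain ⟨i, j, hij, h⟩ := (hleaf.union hprod).exists_lt (f := f) fun n => by
    cases hn : f n with
    | of x => exact Or.inl ⟨x, rfl⟩
    | mul x y =>
      have hpos : ∀ t : FreeMagma ι, 0 < t.length := FreeMagma.length_pos
      refine Or.inr ⟨(x, y), ⟨⟨n, ?_, ?_⟩, ⟨n, ?_, ?_⟩⟩, rfl⟩
      · rw [hn]; exact Nat.lt_add_of_pos_right (hpos y)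
      · rw [hn]; simpa [hr] using mul_le_left _ _
      · rw [hn]; exact Nat.lt_add_of_pos_left (hpos x)
      · rw [hn]; simpa [hr] using mul_le_right _ _
  exact hf.2 i j hij h

/-- The submonoid generated by a finite set in an integral preordered unital magma is dually
well-quasi-ordered. -/
theorem Submonoid.closure_partiallyWellOrderedOn_ge {N : Type*} [MulOneClass N] [Preorder N]
    (mul_mono : ∀ a b c d : N, a ≤ b → c ≤ d → a * c ≤ b * d)
    (le_one : ∀ a : N, a ≤ 1) {F : Set N} (hF : F.Finite) :
    (Submonoid.closure F : Set N).PartiallyWellOrderedOn (· ≥ ·) := by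
  -- A free magma has no empty product, so `1` must be among the generators.
  have : Finite ↥(insert 1 F) := (hF.insert 1).to_subtype
  let φ : FreeMagma ↥(insert 1 F) →ₙ* N := FreeMagma.lift Subtype.val
  have hwqo := FreeMagma.wellQuasiOrdered_eval mul_mono
    (fun a b => by simpa using mul_mono a a b 1 le_rfl (le_one b))
    (fun a b => by simpa using mul_mono a 1 b b (le_one a) le_rfl) φ
  have hsurj : ∀ x ∈ Submonoid.closure F, ∃ t, φ t = x := by
    intro x hx
    induction hx using Submonoid.closure_induction with
    | mem x hx => exact ⟨.of ⟨x, Or.inr hx⟩, rfl⟩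
    | one => exact ⟨.of ⟨1, Or.inl rfl⟩, rfl⟩
    | mul x y _ _ hx hy =>
      obtain ⟨s, rfl⟩ := hx
      obtain ⟨t, rfl⟩ := hy
      exact ⟨s * t, map_mul _ _ _⟩
  rw [Set.partiallyWellOrderedOn_iff_exists_lt]
  intro f hf
  choose g hg using fun n => hsurj (f n) (hf n)
  obtain ⟨i, j, hij, h⟩ := hwqo g
  exact ⟨i, j, hij, by simpa only [hg] using h⟩

/-- A family of lower sets of a dually well-quasi-ordered set is finite as soon as it is
well-quasi-ordered by inclusion. -/
theorem Set.finite_of_isLowerSet_of_partiallyWellOrderedOn {M : Type*} [Preorder M]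
    (hM : WellQuasiOrdered (fun x y : M => y ≤ x)) {𝓑 : Set (Set M)}
    (hlower : ∀ U ∈ 𝓑, IsLowerSet U) (h𝓑 : 𝓑.PartiallyWellOrderedOn (· ≤ ·)) : 𝓑.Finite := by
  by_contra hinf
  have : Infinite 𝓑 := Set.infinite_coe_iff.2 hinf
  let f := _root_.Infinite.natEmbedding 𝓑
  obtain ⟨g, hg⟩ := h𝓑.exists_monotone_subseq (f := fun n => (f n : Set M)) fun n => (f n).2
  -- An increasing sequence of distinct sets gains a point at every step. These points form a bad
  -- sequence, because the sets are down-closed.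
  have hne : ∀ n, ∃ m, m ∈ (f (g (n + 1)) : Set M) ∧ m ∉ (f (g n) : Set M) := by
    intro n
    by_contra! hcon
    have heq : (f (g n) : Set M) = f (g (n + 1)) := (hg _ _ n.le_succ).antisymm hcon
    have := g.injective (f.injective (Subtype.ext heq))
    omega
  choose m hm hm' using hne
  obtain ⟨i, j, hij, h⟩ := hM m
  exact hm' j (hlower _ (f (g j)).2 h (hg (i + 1) j hij (hm i)))

/-! ## Galois algebras -/

/-- The closure operator on `Set M` whose closed sets are the intersections of members of `𝓑`. -/
def basisClosure {M : Type*} (𝓑 : Set (Set M)) : ClosureOperator (Set M) :=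
  ClosureOperator.mk₂ (fun X => ⋂₀ {U ∈ 𝓑 | X ⊆ U})
    (fun _ => Set.subset_sInter fun _ hU => hU.2)
    (fun _ _ h => Set.subset_sInter fun _ hU =>
      Set.sInter_subset_of_mem ⟨hU.1, h.trans (Set.sInter_subset_of_mem hU)⟩)

section basisClosure

variable {M : Type*} {𝓑 : Set (Set M)}

theorem mem_basisClosure {X : Set M} {m : M} :
    m ∈ basisClosure 𝓑 X ↔ ∀ U ∈ 𝓑, X ⊆ U → m ∈ U := by
  change m ∈ ⋂₀ {U ∈ 𝓑 | X ⊆ U} ↔ _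
  simp only [Set.mem_sInter, Set.mem_ofPred_eq, and_imp]

theorem isClosed_basisClosure_of_mem {U : Set M} (hU : U ∈ 𝓑) : (basisClosure 𝓑).IsClosed U :=
  (basisClosure 𝓑).isClosed_iff_closure_le.2 fun _ hm => mem_basisClosure.1 hm U hU subset_rfl

theorem mem_closed_iff {X : Set M} (hX : (basisClosure 𝓑).IsClosed X) {m : M} :
    m ∈ X ↔ ∀ U ∈ 𝓑, X ⊆ U → m ∈ U := by
  rw [← mem_basisClosure, hX.closure_eq]

/-- A closed set is determined by the basic sets that contain it. -/
theorem finite_closeds_basisClosure (h : 𝓑.Finite) : Finite (basisClosure 𝓑).Closeds := by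
  have : Finite (𝒫 𝓑) := h.finite_subsets.to_subtype
  refine Finite.of_injective
    (fun X : (basisClosure 𝓑).Closeds => (⟨{U ∈ 𝓑 | X.1 ⊆ U}, fun _ hU => hU.1⟩ : 𝒫 𝓑)) ?_
  intro X Y hXY
  have hXY : {U ∈ 𝓑 | X.1 ⊆ U} = {U ∈ 𝓑 | Y.1 ⊆ U} := congrArg Subtype.val hXY
  apply Subtype.ext
  rw [← X.2.closure_eq, ← Y.2.closure_eq]
  exact congrArg Set.sInter hXY

variable [Mul M]

/-- Residuals of basic sets by single elements are basic, so the closure can be removed from one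
factor at a time. -/
theorem closure_mul_closure_subset
    (hl : ∀ U ∈ 𝓑, ∀ m : M, {y | m * y ∈ U} ∈ 𝓑) (hr : ∀ U ∈ 𝓑, ∀ m : M, {x | x * m ∈ U} ∈ 𝓑)
    (X Y : Set M) :
    basisClosure 𝓑 X * basisClosure 𝓑 Y ⊆ basisClosure 𝓑 (X * Y) := by
  rintro _ ⟨x, hx, y, hy, rfl⟩
  refine mem_basisClosure.2 fun U hU hXY => ?_
  refine mem_basisClosure.1 hx _ (hr U hU y) fun x' hx' => ?_
  exact mem_basisClosure.1 hy _ (hl U hU x') fun y' hy' => hXY ⟨x', hx', y', hy', rfl⟩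

end basisClosure

/-- The data of a Galois algebra: a nucleus on the powerset of a unital magma, a submonoid that
carries the conucleus, and an element that interprets zero. -/
structure NucleusFrame (M : Type*) [MulOneClass M] where
  /-- the nucleus -/
  cl : ClosureOperator (Set M)
  cl_mul_cl : ∀ X Y : Set M, cl X * cl Y ⊆ cl (X * Y)
  /-- the submonoid of modal elements -/
  modal : Submonoid M
  /-- the interpretation of zero -/
  zero : M

namespace NucleusFrame

variable {M : Type*} [MulOneClass M] (W : NucleusFrame M)

theorem cl_mul_cl_eq (X Y : Set M) : W.cl (W.cl X * W.cl Y) = W.cl (X * Y) :=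
  (W.cl.closure_min (W.cl_mul_cl X Y) (W.cl.isClosed_closure _)).antisymm
    (W.cl.monotone (Set.mul_subset_mul (W.cl.le_closure X) (W.cl.le_closure Y)))

theorem cl_mul_left (X Y : Set M) : W.cl (W.cl X * Y) = W.cl (X * Y) := by
  rw [← cl_mul_cl_eq, W.cl.idempotent, cl_mul_cl_eq]

theorem cl_mul_right (X Y : Set M) : W.cl (X * W.cl Y) = W.cl (X * Y) := by
  rw [← cl_mul_cl_eq, W.cl.idempotent, cl_mul_cl_eq]

theorem cl_singleton_one_mul (X : W.cl.Closeds) : W.cl (W.cl {1} * X.1) = X.1 := by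
  rw [cl_mul_left, Set.singleton_mul]
  simpa using X.2.closure_eq

theorem mul_cl_singleton_one (X : W.cl.Closeds) : W.cl (X.1 * W.cl {1}) = X.1 := by
  rw [cl_mul_right, Set.mul_singleton]
  simpa using X.2.closure_eq

theorem isClosed_ldiv (X : Set M) {Z : Set M} (hZ : W.cl.IsClosed Z) :
    W.cl.IsClosed {y | ∀ x ∈ X, x * y ∈ Z} := by
  refine W.cl.isClosed_iff_closure_le.2 fun y hy x hx => ?_
  rw [← hZ.closure_eq]
  refine W.cl.monotone ?_ (W.cl_mul_cl X _ (Set.mul_mem_mul (W.cl.le_closure X hx) hy))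
  rintro _ ⟨x, hx, y, hy, rfl⟩
  exact hy x hx

theorem isClosed_rdiv (Y : Set M) {Z : Set M} (hZ : W.cl.IsClosed Z) :
    W.cl.IsClosed {x | ∀ y ∈ Y, x * y ∈ Z} := by
  refine W.cl.isClosed_iff_closure_le.2 fun x hx y hy => ?_
  rw [← hZ.closure_eq]
  refine W.cl.monotone ?_ (W.cl_mul_cl _ Y (Set.mul_mem_mul hx (W.cl.le_closure Y hy)))
  rintro _ ⟨x, hx, y, hy, rfl⟩
  exact hx y hy

/-- The algebra of closed sets. -/
@[reducible]
def galoisAlgebra : InteriorRluzGroupoid W.cl.Closeds where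
  toLattice := W.cl.gi.liftCompleteLattice.toLattice
  mul X Y := W.cl.toCloseds (X.1 * Y.1)
  one := W.cl.toCloseds {1}
  one_mul X := Subtype.ext (W.cl_singleton_one_mul X)
  mul_one X := Subtype.ext (W.mul_cl_singleton_one X)
  zero := W.cl.toCloseds {W.zero}
  ldiv X Z := ⟨{y | ∀ x ∈ X.1, x * y ∈ Z.1}, W.isClosed_ldiv _ Z.2⟩
  rdiv Z Y := ⟨{x | ∀ y ∈ Y.1, x * y ∈ Z.1}, W.isClosed_rdiv _ Z.2⟩
  bang X := W.cl.toCloseds (X.1 ∩ W.modal)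
  mul_le_iff_le_ldiv X Y Z := by
    refine Iff.trans (Z.2.closure_le_iff (x := X.1 * Y.1)) ?_
    exact Set.mul_subset_iff.trans ⟨fun h y hy x hx => h x hx y hy, fun h x hx y hy => h hy x hx⟩
  mul_le_iff_le_rdiv X Y Z := by
    refine Iff.trans (Z.2.closure_le_iff (x := X.1 * Y.1)) ?_
    exact Set.mul_subset_iff
  one_le_bang_one := by
    refine W.cl.monotone (Set.singleton_subset_iff.2 ?_)
    exact ⟨W.cl.le_closure {1} rfl, W.modal.one_mem⟩
  bang_mul_bang_le X Y := by
    refine (W.cl_mul_cl_eq (X.1 ∩ W.modal) (Y.1 ∩ W.modal)).le.trans (W.cl.monotone ?_)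
    rintro _ ⟨x, hx, y, hy, rfl⟩
    exact ⟨W.cl.le_closure _ (Set.mul_mem_mul hx.1 hy.1), W.modal.mul_mem hx.2 hy.2⟩
  bang_le X := W.cl.closure_min Set.inter_subset_left X.2
  bang_le_bang_bang X :=
    W.cl.monotone (Set.subset_inter (W.cl.le_closure (X.1 ∩ W.modal)) Set.inter_subset_right)
  bang_mono X Y h := W.cl.monotone (Set.inter_subset_inter_left _ h)

end NucleusFrame

/-! ### Polynomials and basic closed sets -/

namespace InteriorRluzGroupoid

variable {A : Type u} [InteriorRluzGroupoid A]

theorem mul_le_mul_both (a b c d : A) (hab : a ≤ b) (hcd : c ≤ d) : a * c ≤ b * d :=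
  ((mul_le_iff_le_rdiv _ _ _).2 (hab.trans ((mul_le_iff_le_rdiv b c _).1 le_rfl))).trans
    ((mul_le_iff_le_ldiv _ _ _).2 (hcd.trans ((mul_le_iff_le_ldiv b d _).1 le_rfl)))

theorem mul_sup_le (a b c : A) : a * (b ⊔ c) ≤ a * b ⊔ a * c :=
  (mul_le_iff_le_ldiv _ _ _).2 (sup_le ((mul_le_iff_le_ldiv _ _ _).1 le_sup_left)
    ((mul_le_iff_le_ldiv _ _ _).1 le_sup_right))

theorem sup_mul_le (a b c : A) : (a ⊔ b) * c ≤ a * c ⊔ b * c :=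
  (mul_le_iff_le_rdiv _ _ _).2 (sup_le ((mul_le_iff_le_rdiv _ _ _).1 le_sup_left)
    ((mul_le_iff_le_rdiv _ _ _).1 le_sup_right))

theorem bang_bang (a : A) : bang (bang a) = bang a :=
  (bang_le _).antisymm (bang_le_bang_bang a)

/-- The elements of the submonoid generated by `F` that are fixed by the conucleus. -/
def modalSubmonoid (F : Set A) : Submonoid (Submonoid.closure F) where
  carrier := {m | bang (m : A) = m}
  one_mem' := (bang_le _).antisymm one_le_bang_one
  mul_mem' := fun {a b} ha hb => (bang_le _).antisymm <| by
    have h := bang_mul_bang_le (a : A) b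
    rw [ha.out, hb.out] at h
    exact h

/-- The polynomial functions with coefficients generated by `F`, as a submonoid of `A → A` with
pointwise multiplication. -/
def polynomials (F : Set A) : Submonoid (A → A) :=
  Submonoid.closure (insert id (Function.const A '' F))

theorem const_mem_polynomials {F : Set A} {m : A} (hm : m ∈ Submonoid.closure F) :
    Function.const A m ∈ polynomials F := by
  induction hm using Submonoid.closure_induction with
  | mem x hx => exact Submonoid.subset_closure (Or.inr ⟨x, hx, rfl⟩)
  | one => exact one_mem (polynomials F)
  | mul x y _ _ hx hy => exact mul_mem hx hy

theorem comp_mem_polynomials {F : Set A} {u v : A → A} (hu : u ∈ polynomials F)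
    (hv : v ∈ polynomials F) : u ∘ v ∈ polynomials F := by
  induction hu using Submonoid.closure_induction with
  | mem u hu =>
    rcases hu with rfl | ⟨m, hm, rfl⟩
    · exact hv
    · exact const_mem_polynomials (Submonoid.subset_closure hm)
  | one => exact one_mem (polynomials F)
  | mul x y _ _ hx hy => exact mul_mem hx hy

theorem id_mem_polynomials (F : Set A) : id ∈ polynomials F :=
  Submonoid.subset_closure (Set.mem_insert _ _)

/-- The polynomial functions that preserve binary joins, and zero if it is the least element. -/
def joinPolynomials (F : Set A) : Set (A → A) :=
  -- A semantic stand-in for polynomials in which the variable occurs once. Monotonicity makes basic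
  -- sets down-closed, the join clause lets the embedding preserve `∨`, and the zero clause serves
  -- equation `o`.
  {u | u ∈ polynomials F ∧ Monotone u ∧ (∀ x y, u (x ⊔ y) ≤ u x ⊔ u y) ∧
    (IsBot (0 : A) → u 0 ≤ 0)}

theorem id_mem_joinPolynomials (F : Set A) : id ∈ joinPolynomials F :=
  ⟨id_mem_polynomials F, monotone_id, fun _ _ => le_rfl, fun _ => le_rfl⟩

theorem comp_mem_joinPolynomials {F : Set A} {u v : A → A} (hu : u ∈ joinPolynomials F)
    (hv : v ∈ joinPolynomials F) : u ∘ v ∈ joinPolynomials F :=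
  ⟨comp_mem_polynomials hu.1 hv.1, hu.2.1.comp hv.2.1,
    fun x y => (hu.2.1 (hv.2.2.1 x y)).trans (hu.2.2.1 _ _),
    fun h => (hu.2.1 (hv.2.2.2 h)).trans (hu.2.2.2 h)⟩

theorem mul_left_mem_joinPolynomials {F : Set A} {m : A} (hm : m ∈ Submonoid.closure F) :
    (fun x => m * x) ∈ joinPolynomials F :=
  ⟨mul_mem (const_mem_polynomials hm) (id_mem_polynomials F),
    fun _ _ h => mul_le_mul_both _ _ _ _ le_rfl h, mul_sup_le m,
    fun h => (mul_le_iff_le_ldiv _ _ _).2 (h _)⟩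

theorem mul_right_mem_joinPolynomials {F : Set A} {m : A} (hm : m ∈ Submonoid.closure F) :
    (fun x => x * m) ∈ joinPolynomials F :=
  ⟨mul_mem (id_mem_polynomials F) (const_mem_polynomials hm),
    fun _ _ h => mul_le_mul_both _ _ _ _ h le_rfl, fun x y => sup_mul_le x y m,
    fun h => (mul_le_iff_le_rdiv _ _ _).2 (h _)⟩

/-- The basic closed sets of the Galois algebra attached to `F`. -/
def basicSets (F : Set A) : Set (Set (Submonoid.closure F)) :=
  {U | ∃ u ∈ joinPolynomials F, ∃ d ∈ F, U = {m : Submonoid.closure F | u m ≤ d}}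

theorem ldiv_mem_basicSets {F : Set A} (U : Set (Submonoid.closure F)) (hU : U ∈ basicSets F)
    (m : Submonoid.closure F) : {y | m * y ∈ U} ∈ basicSets F := by
  obtain ⟨u, hu, d, hd, rfl⟩ := hU
  exact ⟨_, comp_mem_joinPolynomials hu (mul_left_mem_joinPolynomials m.2), d, hd, rfl⟩

theorem rdiv_mem_basicSets {F : Set A} (U : Set (Submonoid.closure F)) (hU : U ∈ basicSets F)
    (m : Submonoid.closure F) : {x | x * m ∈ U} ∈ basicSets F := by
  obtain ⟨u, hu, d, hd, rfl⟩ := hU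
  exact ⟨_, comp_mem_joinPolynomials hu (mul_right_mem_joinPolynomials m.2), d, hd, rfl⟩

theorem finite_basicSets (le_one : ∀ a : A, a ≤ 1) {F : Set A} (hF : F.Finite) :
    (basicSets F).Finite := by
  have hunion : basicSets F = ⋃ d ∈ F, (fun u : A → A => {m : Submonoid.closure F | u m ≤ d}) ''
      joinPolynomials F := by
    ext U
    simp only [basicSets, Set.mem_ofPred_eq, Set.mem_iUnion, Set.mem_image, exists_prop]
    constructor
    · rintro ⟨u, hu, d, hd, rfl⟩
      exact ⟨d, hd, u, hu, rfl⟩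
    · rintro ⟨d, hd, u, hu, rfl⟩
      exact ⟨u, hu, d, hd, rfl⟩
  rw [hunion]
  refine hF.biUnion fun d _ => Set.finite_of_isLowerSet_of_partiallyWellOrderedOn
    (Submonoid.closure_partiallyWellOrderedOn_ge mul_le_mul_both le_one hF) ?_ ?_
  · rintro _ ⟨u, hu, rfl⟩ x y hyx hx
    exact (hu.2.1 hyx).trans hx
  -- The Kruskal argument applies again, now in `A → A`, with the identity and the constants from
  -- `F` as generators. Smaller polynomials give larger basic sets.
  · have hpoly : (joinPolynomials F).PartiallyWellOrderedOn (· ≥ ·) :=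
      (Submonoid.closure_partiallyWellOrderedOn_ge
        (fun a b c d (hab : ∀ x, a x ≤ b x) (hcd : ∀ x, c x ≤ d x) x =>
          mul_le_mul_both _ _ _ _ (hab x) (hcd x))
        (fun a x => le_one (a x)) ((hF.image _).insert _)).mono fun u hu => hu.1
    exact hpoly.image_of_monotone_on fun u _ v _ huv m hm => (huv m).trans hm

/-- The frame attached to a set `F` of elements that contains zero. -/
@[reducible]
def frame (F : Set A) (h0 : 0 ∈ F) : NucleusFrame (Submonoid.closure F) where
  cl := basisClosure (basicSets F)
  cl_mul_cl := closure_mul_closure_subset ldiv_mem_basicSets rdiv_mem_basicSets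
  modal := modalSubmonoid F
  zero := ⟨0, Submonoid.subset_closure h0⟩

/-! ### The embedding and the transfer of equations -/

section frame

variable {F : Set A}

theorem isLowerSet_of_isClosed {X : Set (Submonoid.closure F)}
    (hX : (basisClosure (basicSets F)).IsClosed X) {m n : Submonoid.closure F}
    (hmn : (m : A) ≤ n) (hn : n ∈ X) : m ∈ X := by
  refine (mem_closed_iff hX).2 ?_
  rintro _ ⟨u, hu, d, hd, rfl⟩ hXU
  exact (hu.2.1 hmn).trans (hXU hn)

theorem sup_mem_of_isClosed {X : Set (Submonoid.closure F)}
    (hX : (basisClosure (basicSets F)).IsClosed X) {a b c : Submonoid.closure F}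
    (ha : a ∈ X) (hb : b ∈ X) (hc : (c : A) = (a : A) ⊔ (b : A)) : c ∈ X := by
  refine (mem_closed_iff hX).2 ?_
  rintro _ ⟨u, hu, d, hd, rfl⟩ hXU
  rw [Set.mem_ofPred_eq, hc]
  exact (hu.2.2.1 _ _).trans (sup_le (hXU ha) (hXU hb))

/-- The principal closed set of an element of `F`. -/
def principal (b : F) : (basisClosure (basicSets F)).Closeds :=
  ⟨{m | (m : A) ≤ b}, isClosed_basisClosure_of_mem
    ⟨id, id_mem_joinPolynomials F, b, b.2, rfl⟩⟩

/-- An element of `F` as an element of the submonoid it generates. -/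
def toClosure (b : F) : Submonoid.closure F := ⟨b, Submonoid.subset_closure b.2⟩

theorem toClosure_mem_principal (b : F) : toClosure b ∈ (principal b).1 := le_refl (b : A)

/-- `principal b` is the least closed set containing `b`, which turns lower bounds on closed sets
into membership statements. -/
theorem principal_le_iff (b : F) (X : (basisClosure (basicSets F)).Closeds) :
    principal b ≤ X ↔ toClosure b ∈ X.1 :=
  ⟨fun h => h (toClosure_mem_principal b), fun h _ hm =>
    isLowerSet_of_isClosed X.2 (n := toClosure b) hm h⟩

theorem toCloseds_le {S : Set (Submonoid.closure F)}
    {X : (basisClosure (basicSets F)).Closeds} (h : S ⊆ X.1) :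
    (basisClosure (basicSets F)).toCloseds S ≤ X :=
  ClosureOperator.closure_min h X.2

theorem principal_injective : Function.Injective (principal : F → _) := fun b c h =>
  Subtype.ext (le_antisymm ((principal_le_iff b _).1 h.le) ((principal_le_iff c _).1 h.ge))

theorem isEmbedding_principal (h0 : 0 ∈ F) {B : Set A} (hB : B ⊆ F) :
    (partialSubalgebra rluzLanguage (algebra (A := A) inferInstance) B).IsEmbedding
      (algebra (frame F h0).galoisAlgebra) (fun b => principal (Set.inclusion hB b)) where
  injective := principal_injective.comp (Set.inclusion_injective hB)
  map_op := by
    let := (frame F h0).galoisAlgebra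
    intro n f xs y hy
    obtain ⟨hmem, rfl⟩ := hy
    have hle := fun b : B => principal_le_iff (Set.inclusion hB b)
    have hcl := (basisClosure (basicSets F)).le_closure
    change RluzOp n at f
    cases f with
    | meet =>
      apply le_antisymm
      · refine le_inf ?_ ?_
        · exact (hle _ _).2 inf_le_left
        · exact (hle _ _).2 inf_le_right
      · intro m hm
        exact le_inf (inf_le_left (a := principal (Set.inclusion hB (xs 0)))
            (b := principal (Set.inclusion hB (xs 1))) hm)
          (inf_le_right (a := principal (Set.inclusion hB (xs 0)))
            (b := principal (Set.inclusion hB (xs 1))) hm)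
    | join =>
      apply le_antisymm
      · refine (hle _ _).2 (sup_mem_of_isClosed (Subtype.property _)
          ((hle (xs 0) _).1 le_sup_left) ((hle (xs 1) _).1 le_sup_right) rfl)
      · refine sup_le ?_ ?_
        · exact (hle _ _).2 le_sup_left
        · exact (hle _ _).2 le_sup_right
    | mul =>
      apply le_antisymm
      · exact (hle _ _).2 (hcl _ (Set.mul_mem_mul
          (toClosure_mem_principal (Set.inclusion hB (xs 0)))
          (toClosure_mem_principal (Set.inclusion hB (xs 1)))))
      · refine toCloseds_le ?_
        rintro _ ⟨a, ha, b, hb, rfl⟩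
        exact mul_le_mul_both _ _ _ _ ha hb
    | ldiv =>
      apply le_antisymm
      · refine (hle _ _).2 fun x hx => ?_
        exact (mul_le_mul_both _ _ _ _ hx le_rfl).trans ((mul_le_iff_le_ldiv _ _ _).2 le_rfl)
      · intro m hm
        exact (mul_le_iff_le_ldiv _ _ _).1
          (hm _ (toClosure_mem_principal (Set.inclusion hB (xs 0))))
    | rdiv =>
      apply le_antisymm
      · refine (hle _ _).2 fun x hx => ?_
        exact (mul_le_mul_both _ _ _ _ le_rfl hx).trans ((mul_le_iff_le_rdiv _ _ _).2 le_rfl)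
      · intro m hm
        exact (mul_le_iff_le_rdiv _ _ _).1
          (hm _ (toClosure_mem_principal (Set.inclusion hB (xs 1))))
    | bang =>
      apply le_antisymm
      -- `!x` is itself a `!`-fixed element below `x`.
      · exact (hle _ _).2 (hcl _ ⟨bang_le (xs 0 : A), bang_bang (xs 0 : A)⟩)
      · refine toCloseds_le ?_
        rintro m ⟨hm, hm'⟩
        exact hm'.out.ge.trans (bang_mono _ _ hm)
    | one =>
      apply le_antisymm
      · exact (hle _ _).2 (hcl _ rfl)
      · refine toCloseds_le ?_
        rintro _ rfl
        exact le_refl (1 : A)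
    | zero =>
      apply le_antisymm
      · exact (hle _ _).2 (hcl _ rfl)
      · refine toCloseds_le ?_
        rintro _ rfl
        exact le_refl (0 : A)

/-- Inner closures are absorbed by an outer one, so identities between products reduce to
elementwise identities in `M`; `c`, `i` and `bangC` use down-closure. -/
theorem holdsIn_galoisAlgebra (le_one : ∀ a : A, a ≤ 1) (h0 : 0 ∈ F) (q : RluzEquation)
    (hq : q.HoldsIn A) :
    letI := (frame F h0).galoisAlgebra
    q.HoldsIn (basisClosure (basicSets F)).Closeds := by
  let W := frame F h0
  let := W.galoisAlgebra
  have hone : ∀ X : (basisClosure (basicSets F)).Closeds, X ≤ 1 := fun X m _ =>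
    isLowerSet_of_isClosed (Subtype.property _) (le_one m)
      ((basisClosure (basicSets F)).le_closure {1} rfl)
  cases q with
  | e =>
    intro X Y
    refine W.cl.monotone ?_
    rintro _ ⟨x, hx, y, hy, rfl⟩
    exact ⟨y, hy, x, hx, Subtype.ext (le_antisymm (hq _ _) (hq _ _))⟩
  | c =>
    intro X x hx
    exact isLowerSet_of_isClosed (X * X).2 (n := x * x) (hq x)
      (W.cl.le_closure _ (Set.mul_mem_mul hx hx))
  | i => exact hone
  | o =>
    intro X
    refine toCloseds_le ?_
    rintro _ rfl
    refine (mem_closed_iff X.2).2 ?_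
    -- Zero lies in every basic set: `u 0 ≤ 0 ≤ d`.
    rintro _ ⟨u, hu, d, hd, rfl⟩ -
    exact (hu.2.2.2 hq).trans (hq d)
  | bangE =>
    intro X Y
    apply Subtype.ext
    change W.cl (W.cl (X.1 ∩ W.modal) * Y.1) = W.cl (Y.1 * W.cl (X.1 ∩ W.modal))
    rw [W.cl_mul_left, W.cl_mul_right]
    congr 1
    ext m
    constructor
    · rintro ⟨x, hx, y, hy, rfl⟩
      -- Modal elements satisfy `!x = x`, so the modal equation of `A` speaks about `x` itself; the
      -- same device recurs below.
      have h := hq x y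
      rw [hx.2.out] at h
      exact ⟨y, hy, x, hx, Subtype.ext h.symm⟩
    · rintro ⟨y, hy, x, hx, rfl⟩
      have h := hq x y
      rw [hx.2.out] at h
      exact ⟨x, hx, y, hy, Subtype.ext h⟩
  | bangC =>
    intro X
    refine toCloseds_le (X := bang X * bang X) ?_
    intro x hx
    have h := hq x
    rw [hx.2.out] at h
    have hmem := W.cl.le_closure _ hx
    exact isLowerSet_of_isClosed (bang X * bang X).2 (n := x * x) h
      (W.cl.le_closure _ (Set.mul_mem_mul hmem hmem))
  | bangI => exact fun X => (bang_le X).trans (hone X)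
  | bangA1 =>
    intro X Y Z
    apply Subtype.ext
    change W.cl (W.cl (X.1 ∩ W.modal) * W.cl (Y.1 * Z.1)) =
      W.cl (W.cl (W.cl (X.1 ∩ W.modal) * Y.1) * Z.1)
    rw [W.cl_mul_cl_eq, W.cl_mul_left _ Y.1, W.cl_mul_left _ Z.1]
    congr 1
    ext m
    constructor
    · rintro ⟨x, hx, _, ⟨y, hy, z, hz, rfl⟩, rfl⟩
      have h := hq x y z
      rw [hx.2.out] at h
      exact ⟨_, ⟨x, hx, y, hy, rfl⟩, z, hz, Subtype.ext h.symm⟩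
    · rintro ⟨_, ⟨x, hx, y, hy, rfl⟩, z, hz, rfl⟩
      have h := hq x y z
      rw [hx.2.out] at h
      exact ⟨x, hx, _, ⟨y, hy, z, hz, rfl⟩, Subtype.ext h⟩
  | bangA2 =>
    intro X Y Z
    apply Subtype.ext
    change W.cl (X.1 * W.cl (Y.1 * W.cl (Z.1 ∩ W.modal))) =
      W.cl (W.cl (X.1 * Y.1) * W.cl (Z.1 ∩ W.modal))
    rw [W.cl_mul_cl_eq, W.cl_mul_right Y.1, W.cl_mul_right X.1]
    congr 1
    ext m
    constructor
    · rintro ⟨x, hx, _, ⟨y, hy, z, hz, rfl⟩, rfl⟩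
      have h := hq x y z
      rw [hz.2.out] at h
      exact ⟨_, ⟨x, hx, y, hy, rfl⟩, z, hz, Subtype.ext h.symm⟩
    · rintro ⟨_, ⟨x, hx, y, hy, rfl⟩, z, hz, rfl⟩
      have h := hq x y z
      rw [hz.2.out] at h
      exact ⟨x, hx, _, ⟨y, hy, z, hz, rfl⟩, Subtype.ext h⟩

end frame

end InteriorRluzGroupoid

open InteriorRluzGroupoid in
/-- Every variety of integral interior `rℓuz`-groupoids axiomatized by equations from the list has
the finite embeddability property. -/
theorem hasFEP_rluzVariety_of_integral {E : Set RluzEquation} (hE : .i ∈ E) :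
    HasFEP.{u} rluzLanguage (rluzVariety E) := by
  rintro A _ ⟨I, rfl, hI⟩ B hB
  -- Zero is adjoined so that `M` contains an element to interpret the constant even when `0 ∉ B`.
  have h0 : (0 : A) ∈ insert 0 B := Set.mem_insert _ _
  have hfin := finite_closeds_basisClosure (finite_basicSets (hI _ hE) (hB.insert 0))
  exact ⟨_, algebra (frame _ h0).galoisAlgebra,
    ⟨_, rfl, fun q hq => holdsIn_galoisAlgebra (hI _ hE) h0 q (hI q hq)⟩, hfin, _,
    isEmbedding_principal h0 (Set.subset_insert 0 B)⟩

theorem mainTheorem5 :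
    (∀ E : Set RluzEquation, E ⊆ {.e, .c, .o, .bangE, .bangC, .bangA1, .bangA2} →
      HasFEP.{u} rluzLanguage (rluzVariety (insert .i E))) ∧
    HasFEP.{u} rluzLanguage (nacillZero {.i}) ∧
    HasFEP.{u} rluzLanguage (nacillZero {.e, .i}) ∧
    HasFEP.{u} rluzLanguage (nacillZero {.c, .i}) ∧
    HasFEP.{u} rluzLanguage (nacillZero {.i, .o}) ∧
    HasFEP.{u} rluzLanguage (nacillZero {.e, .i, .o}) ∧
    HasFEP.{u} rluzLanguage (nacillZero {.c, .i, .o}) := by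
  have h : ∀ R : Set RluzEquation, .i ∈ R → HasFEP.{u} rluzLanguage (nacillZero R) := fun _ hR =>
    hasFEP_rluzVariety_of_integral (Or.inr hR)
  refine ⟨fun E _ => hasFEP_rluzVariety_of_integral (Set.mem_insert _ _), ?_, ?_, ?_, ?_, ?_, ?_⟩ <;>
    exact h _ (by simp)
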